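/- Let $\Bbbk$ be a field of characteristic zero, and let $W_+$ be the positive Witt algebra, that is, the Lie algebra over $\Bbbk$ with basis $\{e_i : i \in \mathbb{Z}_{\geq 1}\}$ and bracket $[e_i,e_j]=(j-i)e_{i+j}$. Let $\mathrm{S}(W_+)=\Bbbk[x_1,x_2,\dots]$ be its symmetric algebra, where $x_i$ is the image of $e_i$, with the Poisson bracket induced by the Lie bracket, so $\{x_i,x_j\}=(j-i)x_{i+j}$. The order $o(f)$ of a nonzero $f\in \mathrm{S}(W_+)$ is its total degree as a polynomial in the $x_i$ (so $o(x_i)=1$ for all $i$). A Poisson ideal of $\mathrm{S}(W_+)$ is an ideal $J$ with $\{\mathrm{S}(W_+),J\}\subseteq J$; then $\mathrm{S}(W_+)/J$ is a Poisson algebra. For a (commutative) Poisson $\Bbbk$-algebra $A$ and a finite-dimensional subspace $V\subseteq A$, put $V^{\{0\}}=\Bbbk$, $V^{\{n+1\}}=V V^{\{n\}}+\{V,V^{\{n\}}\}$ and $\mathrm{pd}_V(n)=\dim\bigl(\sum_{i=0}^n V^{\{i\}}\bigr)$. If $V$ generates $A$ as a Poisson algebra, the Poisson Gelfand–Kirillov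 dimension $\operatorname{PGKdim} A$ is the infimum of those real $\gamma\geq 0$ for which there are $c,m\in\mathbb{N}$ with $\mathrm{pd}_V(n)\leq c\,(mn)^\gamma$ for all but finitely many $n$ (it is $\infty$ if there is no such $\gamma$, and it does not depend on $V$); for arbitrary $A$, $\operatorname{PGKdim} A$ is the supremum of $\operatorname{PGKdim} A'$ over all finitely generated Poisson subalgebras $A'$ of $A$. Proposition. Let $J$ be a Poisson ideal of $\mathrm{S}(W_+)$ that contains a nonzero element of order at most two. Then $$\operatorname{PGKdim}\bigl(\mathrm{S}(W_+)/J\bigr)<\infty .$$ -/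

import Mathlib

open scoped NNReal ENNReal

noncomputable section

/-- A Poisson structure over `k` on a commutative `k`-algebra `A`: a `k`-bilinear Lie bracket
which is a derivation in each argument (in the first one by antisymmetry). -/
structure PoissonStructure (k A : Type*) [Field k] [CommRing A] [Algebra k A] where
  bracket : A →ₗ[k] A →ₗ[k] A
  bracket_self : ∀ a, bracket a a = 0
  jacobi : ∀ a b c,
    bracket a (bracket b c) + bracket b (bracket c a) + bracket c (bracket a b) = 0
  leibniz : ∀ a b c, bracket a (b * c) = b * bracket a c + c * bracket a b

namespace PoissonStructure

section General

variable {k A : Type*} [Field k] [CommRing A] [Algebra k A] (P : PoissonStructure k A)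

/-- Poisson ideals: ideals `I` with `{A, I} ⊆ I`. -/
def IsPoissonIdeal (I : Ideal A) : Prop :=
  ∀ a : A, ∀ b ∈ I, P.bracket a b ∈ I

/-- Poisson subalgebras: (unital) subalgebras closed under the bracket. -/
def IsPoissonSubalgebra (B : Subalgebra k A) : Prop :=
  ∀ a ∈ B, ∀ b ∈ B, P.bracket a b ∈ B

/-- The subspace `V` generates `B` as a Poisson algebra: `B` is the smallest Poisson subalgebra
that contains `V`. -/
def Generates (V : Submodule k A) (B : Subalgebra k A) : Prop :=
  IsLeast {C : Subalgebra k A | P.IsPoissonSubalgebra C ∧ (V : Set A) ⊆ C} B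

/-- The subspaces `V^{n}`: `V^{0} = k` and `V^{n+1} = V V^{n} + {V, V^{n}}`. -/
def bracePow (V : Submodule k A) : ℕ → Submodule k A
  | 0 => 1
  | n + 1 => V * bracePow V n ⊔ Submodule.map₂ P.bracket V (bracePow V n)

/-- `pd_V(n) = dim (V^{0} + ... + V^{n})`, used for finite-dimensional `V`. -/
def pd (V : Submodule k A) (n : ℕ) : ℕ :=
  Module.finrank k (⨆ i ∈ Finset.range (n + 1), P.bracePow V i : Submodule k A)

end General

end PoissonStructure

/-- `f ≤* g`: there are `c, m` with `f n ≤ c * g (m * n)` for all but finitely many `n`. -/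
def GrowthLE (f g : ℕ → ℝ) : Prop :=
  ∃ c m : ℕ, ∀ᶠ n : ℕ in Filter.atTop, f n ≤ c * g (m * n)

/-- `inf {γ ≥ 0 : f ≤* n^γ}`, which is `∞` if there is no such `γ`. -/
def growthExponent (f : ℕ → ℝ) : ℝ≥0∞ :=
  ⨅ (γ : ℝ≥0) (_ : GrowthLE f (fun n => (n : ℝ) ^ (γ : ℝ))), (γ : ℝ≥0∞)

namespace PoissonStructure

section General

variable {k A : Type*} [Field k] [CommRing A] [Algebra k A] (P : PoissonStructure k A)

/-- The Poisson Gelfand-Kirillov dimension: the supremum, over the Poisson subalgebras `B` that are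
generated by a finite-dimensional subspace `V`, of the growth exponent of `pd_V`. The latter depends
only on `B`, and `pd_V` is the same whether computed in `B` or in `A`. -/
def pgkDim : ℝ≥0∞ :=
  ⨆ (B : Subalgebra k A) (V : Submodule k A) (_ : FiniteDimensional k V) (_ : P.Generates V B),
    growthExponent (fun n => (P.pd V n : ℝ))

theorem neg_bracket (a b : A) : -P.bracket a b = P.bracket b a := by
  have h := P.bracket_self (a + b)
  simp only [map_add, LinearMap.add_apply, P.bracket_self, zero_add, add_zero] at h
  exact neg_eq_of_add_eq_zero_left h

/-- The induced Poisson structure on the quotient by a Poisson ideal. -/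
def quotient (I : Ideal A) (hI : P.IsPoissonIdeal I) : PoissonStructure k (A ⧸ I) where
  bracket := LinearMap.mk₂ k
    (Quotient.map₂ (fun a b => P.bracket a b) (by
      intro a a' ha b b' hb
      have ha' : a - a' ∈ I := (Submodule.quotientRel_def I).1 ha
      have hb' : b - b' ∈ I := (Submodule.quotientRel_def I).1 hb
      refine (Submodule.quotientRel_def I).2 ?_
      have h : P.bracket a b - P.bracket a' b'
          = P.bracket a (b - b') - P.bracket b' (a - a') := by
        rw [← P.neg_bracket (a - a') b']
        simp only [map_sub, LinearMap.sub_apply]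
        ring
      rw [h]
      exact I.sub_mem (hI _ _ hb') (hI _ _ ha')))
    (by
      rintro ⟨a⟩ ⟨b⟩ ⟨c⟩
      exact congrArg (Ideal.Quotient.mk I) (by simp : P.bracket (a + b) c = _))
    (by
      rintro r ⟨a⟩ ⟨b⟩
      exact congrArg (Ideal.Quotient.mk I) (by simp : P.bracket (r • a) b = r • _))
    (by
      rintro ⟨a⟩ ⟨b⟩ ⟨c⟩
      exact congrArg (Ideal.Quotient.mk I) (by simp : P.bracket a (b + c) = _))
    (by
      rintro r ⟨a⟩ ⟨b⟩
      exact congrArg (Ideal.Quotient.mk I) (by simp : P.bracket a (r • b) = r • _))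
  bracket_self := by
    rintro ⟨a⟩
    exact congrArg (Ideal.Quotient.mk I) (P.bracket_self a)
  jacobi := by
    rintro ⟨a⟩ ⟨b⟩ ⟨c⟩
    exact congrArg (Ideal.Quotient.mk I) (P.jacobi a b c)
  leibniz := by
    rintro ⟨a⟩ ⟨b⟩ ⟨c⟩
    exact congrArg (Ideal.Quotient.mk I) (P.leibniz a b c)

theorem quotient_bracket_mk (I : Ideal A) (hI : P.IsPoissonIdeal I) (a b : A) :
    (P.quotient I hI).bracket (Ideal.Quotient.mk I a) (Ideal.Quotient.mk I b)
      = Ideal.Quotient.mk I (P.bracket a b) :=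
  rfl

end General

end PoissonStructure

/-- The symmetric algebra `S(W_+)` of the positive Witt algebra `W_+` (the Lie algebra with basis
`e_i`, `i ≥ 1`, and bracket `[e_i, e_j] = (j - i) e_{i+j}`): the polynomial ring `k[x_1, x_2, ...]`,
where `x_i` is the image of `e_i`. -/
abbrev SymWitt (k : Type*) [Field k] : Type _ := MvPolynomial ℕ+ k

namespace SymWitt

open MvPolynomial

section Bracket

variable (k : Type*) [Field k]

/-- The derivation `{x_i, -}` of `S(W_+)`, with `{x_i, x_j} = (j - i) x_{i+j}`. -/
def adX (i : ℕ+) : Derivation k (SymWitt k) (SymWitt k) :=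
  mkDerivation k fun j => (((j : ℕ) : k) - ((i : ℕ) : k)) • X (i + j)

/-- The derivation `{-, g}` of `S(W_+)`, with `x_i ↦ {x_i, g}`. -/
def bracketRight (g : SymWitt k) : Derivation k (SymWitt k) (SymWitt k) :=
  mkDerivation k fun i => adX k i g

/-- The bracket of `S(W_+)`: the biderivation with `{x_i, x_j} = (j - i) x_{i+j}`. -/
def bracket : SymWitt k →ₗ[k] SymWitt k →ₗ[k] SymWitt k :=
  LinearMap.mk₂ k (fun f g => bracketRight k g f)
    (fun f f' g => map_add _ f f')
    (fun r f g => Derivation.map_smul _ r f)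
    (fun f g g' => by
      have h : bracketRight k (g + g') = bracketRight k g + bracketRight k g' :=
        derivation_ext fun i => by simp [bracketRight, mkDerivation_X]
      rw [h, Derivation.add_apply])
    (fun r f g => by
      have h : bracketRight k (r • g) = r • bracketRight k g :=
        derivation_ext fun i => by simp [bracketRight, mkDerivation_X]
      rw [h, Derivation.smul_apply])

variable {k}

theorem bracket_X_left (i : ℕ+) (g : SymWitt k) : bracket k (X i) g = adX k i g := by
  simp [bracket, bracketRight, mkDerivation_X]

theorem bracket_X_X (i j : ℕ+) :
    bracket k (X i) (X j) = (((j : ℕ) : k) - ((i : ℕ) : k)) • X (i + j) := by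
  simp [bracket_X_left, adX, mkDerivation_X]

theorem bracket_mul_left (a b g : SymWitt k) :
    bracket k (a * b) g = a * bracket k b g + b * bracket k a g := by
  simp [bracket]

theorem bracket_C_left (r : k) (g : SymWitt k) : bracket k (C r) g = 0 := by
  simp [bracket]

theorem bracket_antisymm (f g : SymWitt k) : bracket k f g = -bracket k g f := by
  have hX : ∀ (i : ℕ+) (g : SymWitt k), bracket k (X i) g = -bracket k g (X i) := by
    intro i g
    rw [bracket_X_left]
    have h : adX k i = -bracketRight k (X i) := derivation_ext fun j => by
      have h1 := bracket_X_X (k := k) i j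
      have h2 := bracket_X_X (k := k) j i
      rw [bracket_X_left] at h1
      have h3 : bracketRight k (X i) (X j) = bracket k (X j) (X i) := rfl
      rw [Derivation.neg_apply, h3, h1, h2, add_comm j i, ← neg_smul, neg_sub]
    rw [h]
    rfl
  have key : ∀ a b : SymWitt k, bracket k g (a * b)
      = a * bracket k g b + b * bracket k g a := by
    intro a b
    induction g using MvPolynomial.induction_on with
    | C r => simp [bracket_C_left]
    | add p q hp hq => simp only [map_add, LinearMap.add_apply, hp, hq]; ring
    | mul_X p n hp =>
      simp only [bracket_mul_left, hp, bracket_X_left, Derivation.leibniz, smul_eq_mul]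
      ring
  induction f using MvPolynomial.induction_on with
  | C r =>
    rw [bracket_C_left, ← mul_one (C r), ← smul_eq_C_mul, map_smul]
    have h1 : bracket k g 1 = 0 := by simpa using key 1 1
    simp [h1]
  | add p q hp hq => simp only [map_add, LinearMap.add_apply, hp, hq]; ring
  | mul_X p n hp => rw [bracket_mul_left, key, hp, hX]; ring

theorem bracket_mul_right (g a b : SymWitt k) :
    bracket k g (a * b) = a * bracket k g b + b * bracket k g a := by
  rw [bracket_antisymm, bracket_mul_left, bracket_antisymm a g, bracket_antisymm b g]
  ring

theorem bracket_C_right (g : SymWitt k) (r : k) : bracket k g (C r) = 0 := by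
  rw [bracket_antisymm, bracket_C_left, neg_zero]

theorem bracket_self (f : SymWitt k) : bracket k f f = 0 := by
  induction f using MvPolynomial.induction_on with
  | C r => exact bracket_C_left r _
  | add p q hp hq =>
    simp only [map_add, LinearMap.add_apply, hp, hq]
    rw [bracket_antisymm p q]
    ring
  | mul_X p n hp =>
    have hn : bracket k (X n) (X n) = (0 : SymWitt k) := by rw [bracket_X_X]; simp
    simp only [bracket_mul_left, bracket_mul_right, hp, hn]
    rw [bracket_antisymm p (X n)]
    ring

theorem jacobi_step (b c p q : SymWitt k)
    (hp : bracket k p (bracket k b c) + bracket k b (bracket k c p)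
      + bracket k c (bracket k p b) = 0)
    (hq : bracket k q (bracket k b c) + bracket k b (bracket k c q)
      + bracket k c (bracket k q b) = 0) :
    bracket k (p * q) (bracket k b c) + bracket k b (bracket k c (p * q))
      + bracket k c (bracket k (p * q) b) = 0 := by
  simp only [bracket_mul_left, bracket_mul_right, map_add]
  rw [bracket_antisymm p b, bracket_antisymm q b] at *
  simp only [map_neg] at *
  linear_combination p * hq + q * hp

theorem jacobi_ext (b c : SymWitt k)
    (h : ∀ i : ℕ+, bracket k (X i) (bracket k b c) + bracket k b (bracket k c (X i))
      + bracket k c (bracket k (X i) b) = 0) (a : SymWitt k) :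
    bracket k a (bracket k b c) + bracket k b (bracket k c a)
      + bracket k c (bracket k a b) = 0 := by
  induction a using MvPolynomial.induction_on with
  | C r => simp [bracket_C_left, bracket_C_right]
  | add p q hp hq =>
    simp only [map_add, LinearMap.add_apply]
    linear_combination hp + hq
  | mul_X p n hp => exact jacobi_step b c p (X n) hp (h n)

theorem bracket_jacobi (a b c : SymWitt k) :
    bracket k a (bracket k b c) + bracket k b (bracket k c a)
      + bracket k c (bracket k a b) = 0 := by
  refine jacobi_ext b c (fun i => ?_) a
  have h1 := jacobi_ext c (X i) (fun j => ?_) b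
  · linear_combination h1
  have h2 := jacobi_ext (X i) (X j) (fun l => ?_) c
  · linear_combination h2
  simp only [bracket_X_X, map_smul, smul_smul]
  rw [show j + (l + i) = l + (i + j) by ac_rfl,
    show i + (j + l) = l + (i + j) by ac_rfl, ← add_smul, ← add_smul]
  convert zero_smul k _
  push_cast
  ring

variable (k)

/-- The Poisson structure of `S(W_+)` induced by the Lie bracket of `W_+`. -/
def poisson : PoissonStructure k (SymWitt k) where
  bracket := bracket k
  bracket_self := bracket_self
  jacobi := bracket_jacobi
  leibniz := bracket_mul_right

end Bracket

/-- The order of an element of `S(W_+)`: its degree for the grading with `o(x_i) = 1`. -/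
def order {k : Type*} [Field k] (f : SymWitt k) : ℕ := f.totalDegree

end SymWitt

end

/-! Multiplying by a power of `x_1`, take `f ∈ J` of order exactly two, and let `x_{i₀} x_{j₀}` with
`i₀ ≤ j₀` be its quadratic monomial with the largest `i₀ + j₀`, then the largest `j₀`. For `a`, `b`
beyond all indices in `f`, the element `{x_a, {x_b, f}}` of `J` has leading term a nonzero multiple
of `x_{a+j₀} x_{b+i₀}`. Two brackets are needed so that both factors can become large. Hence, modulo
`J`, every `x_s x_t` with `N < s ≤ t` is a combination of products with smaller index sum, or the
same sum and smaller first index, and of single variables (`exists_X_mul_X_mem_lowerSpan_sup`).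
Iterating this, `S(W_+)/J` is spanned by monomials with at most one variable of index above `N`
(`X_mul_X_mem_lowSpan_sup`, `filt_le_lowSpan_sup`).

The linear terms of `f` yield variables whose index may exceed `s + t` by a bounded amount `C`.
Giving `x_i` the weight `i + C` compensates: such a variable has weight at most `s + t + 2C`, the
weight of `x_s x_t`, so no reduction raises the weight. The weight filtration respects product and
bracket, and its `n`-th piece modulo `J` has dimension at most `(n + 1)^(N + 1)`. One such
filtration bounds all finitely generated Poisson subalgebras at once (`pgkDim_le_of_filtration`), so
the dimension is at most `N + 1`. -/

namespace SymWitt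

open MvPolynomial

variable {k : Type*} [Field k]

/-! ### The weight filtration and its compatibility with the Poisson structure -/

/-- The weight of a monomial for which `x_i` has weight `i + C`. -/
noncomputable def wt (C : ℕ) : (ℕ+ →₀ ℕ) →+ ℕ := Finsupp.weight fun i : ℕ+ => (i : ℕ) + C

/-- The number of factors `x_i` with `i > N` of a monomial, counted with multiplicity. -/
noncomputable def numLarge (N : ℕ) : (ℕ+ →₀ ℕ) →+ ℕ :=
  Finsupp.weight fun i : ℕ+ => if N < (i : ℕ) then 1 else 0

theorem wt_single_one (C : ℕ) (i : ℕ+) : wt C (Finsupp.single i 1) = i + C := by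
  simp [wt, Finsupp.weight_single]

theorem numLarge_single_one (N : ℕ) (i : ℕ+) :
    numLarge N (Finsupp.single i 1) = if N < (i : ℕ) then 1 else 0 := by
  simp [numLarge, Finsupp.weight_single]

theorem monomial_add_one (α β : ℕ+ →₀ ℕ) :
    (monomial (α + β) 1 : SymWitt k) = monomial α 1 * monomial β 1 := by
  simp [monomial_mul]

theorem exists_eq_add_single {N : ℕ} {α : ℕ+ →₀ ℕ} (h : numLarge N α ≠ 0) :
    ∃ (β : ℕ+ →₀ ℕ) (j : ℕ+), N < (j : ℕ) ∧ α = β + Finsupp.single j 1 := by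
  by_contra! hc
  apply h
  rw [numLarge, Finsupp.weight_apply]
  refine Finset.sum_eq_zero fun j hj => ?_
  have hj' : α j ≠ 0 := Finsupp.mem_support_iff.1 hj
  by_cases hN : N < (j : ℕ)
  · exact absurd (Finsupp.sub_add_single_one_cancel hj').symm (hc _ j hN)
  · simp [hN]

variable (k) in
/-- The filtration of `S(W_+)` by weight. -/
noncomputable def filt (C n : ℕ) : Submodule k (SymWitt k) :=
  Submodule.span k {p | ∃ α, wt C α ≤ n ∧ monomial α 1 = p}

theorem monomial_mem_filt {C n : ℕ} {α : ℕ+ →₀ ℕ} (h : wt C α ≤ n) :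
    monomial α 1 ∈ filt k C n :=
  Submodule.subset_span ⟨α, h, rfl⟩

theorem filt_mono (C : ℕ) : Monotone (filt k C) := fun _ _ h =>
  Submodule.span_mono fun _ ⟨α, hα, e⟩ => ⟨α, hα.trans h, e⟩

theorem X_mem_filt {C n : ℕ} {i : ℕ+} (h : (i : ℕ) + C ≤ n) : X i ∈ filt k C n :=
  monomial_mem_filt (by rwa [wt_single_one])

theorem mul_mem_filt {C m n : ℕ} {p q : SymWitt k} (hp : p ∈ filt k C m) (hq : q ∈ filt k C n) :
    p * q ∈ filt k C (m + n) := by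
  have h := Submodule.mul_mem_mul hp hq
  rw [filt, filt, Submodule.span_mul_span] at h
  refine Submodule.span_mono ?_ h
  rintro _ ⟨_, ⟨α, hα, rfl⟩, _, ⟨β, hβ, rfl⟩, rfl⟩
  exact ⟨α + β, by rw [map_add]; exact add_le_add hα hβ, monomial_add_one α β⟩

/-- By the Leibniz rule, a bound on the variables propagates to all monomials. It is used once for
each argument of the bracket. -/
theorem derivation_mem_filt {C d : ℕ} (D : Derivation k (SymWitt k) (SymWitt k))
    (hD : ∀ i : ℕ+, D (X i) ∈ filt k C (i + C + d)) {n : ℕ} {p : SymWitt k}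
    (hp : p ∈ filt k C n) : D p ∈ filt k C (n + d) := by
  have key : ∀ α, D (monomial α 1) ∈ filt k C (wt C α + d) := by
    intro α
    have hadd : ∀ β γ, D (monomial β 1) ∈ filt k C (wt C β + d) →
        D (monomial γ 1) ∈ filt k C (wt C γ + d) →
        D (monomial (β + γ) 1) ∈ filt k C (wt C (β + γ) + d) := by
      intro β γ hβ hγ
      rw [monomial_add_one, D.leibniz, map_add, smul_eq_mul, smul_eq_mul]
      refine add_mem ?_ ?_
      · rw [add_assoc]
        exact mul_mem_filt (monomial_mem_filt le_rfl) hγ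
      · rw [add_comm (wt C β), add_assoc]
        exact mul_mem_filt (monomial_mem_filt le_rfl) hβ
    have hzero : D (monomial 0 1) ∈ filt k C (wt C 0 + d) := by
      have : (monomial 0 1 : SymWitt k) = 1 := rfl
      rw [this, D.map_one_eq_zero]
      exact zero_mem _
    induction α using Finsupp.induction_linear with
    | zero => exact hzero
    | add β γ hβ hγ => exact hadd β γ hβ hγ
    | single i e =>
      induction e with
      | zero => simp
      | succ e ih =>
        rw [Finsupp.single_add]
        refine hadd _ _ ih ?_
        rw [wt_single_one]
        exact hD i
  induction hp using Submodule.span_induction with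
  | mem p hp =>
    obtain ⟨α, hα, rfl⟩ := hp
    exact filt_mono C (Nat.add_le_add_right hα d) (key α)
  | zero => simp
  | add p q _ _ hp hq => rw [map_add]; exact add_mem hp hq
  | smul c p _ hp => rw [D.map_smul]; exact Submodule.smul_mem _ c hp

/-- On variables there is room to spare: `{x_i, x_j}` has weight at most `i + j + C`, against `i + j
+ 2C`. -/
theorem bracket_mem_filt {C m n : ℕ} {p q : SymWitt k} (hp : p ∈ filt k C m)
    (hq : q ∈ filt k C n) : bracket k p q ∈ filt k C (m + n) := by
  refine derivation_mem_filt (bracketRight k q) (fun i => ?_) hp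
  rw [bracketRight, mkDerivation_X, add_comm]
  refine derivation_mem_filt (adX k i) (fun j => ?_) hq
  rw [adX, mkDerivation_X]
  refine Submodule.smul_mem _ _ (X_mem_filt ?_)
  rw [PNat.add_coe]
  omega

theorem exists_mem_filt (C : ℕ) (p : SymWitt k) : ∃ n, p ∈ filt k C n := by
  refine ⟨p.support.sup (wt C), ?_⟩
  rw [p.as_sum]
  refine Submodule.sum_mem _ fun α hα => ?_
  rw [← mul_one (coeff α p), ← smul_eq_mul, ← smul_monomial, ← p.as_sum]
  exact Submodule.smul_mem _ _ (monomial_mem_filt (Finset.le_sup hα))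

/-! ### Monomials with at most one variable of large index -/

variable (k) in
/-- The span of the monomials of weight at most `d` with at most one factor `x_i` with `i > N`. -/
noncomputable def lowSpan (N C d : ℕ) : Submodule k (SymWitt k) :=
  Submodule.span k {p | ∃ α, numLarge N α ≤ 1 ∧ wt C α ≤ d ∧ monomial α 1 = p}

theorem monomial_mem_lowSpan {N C d : ℕ} {α : ℕ+ →₀ ℕ} (h : numLarge N α ≤ 1) (h' : wt C α ≤ d) :
    monomial α 1 ∈ lowSpan k N C d :=
  Submodule.subset_span ⟨α, h, h', rfl⟩

theorem lowSpan_mono (N C : ℕ) : Monotone (lowSpan k N C) := fun _ _ h =>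
  Submodule.span_mono fun _ ⟨α, hα, hα', e⟩ => ⟨α, hα, hα'.trans h, e⟩

theorem X_mem_lowSpan {N C d : ℕ} {u : ℕ+} (hu : (u : ℕ) + C ≤ d) : X u ∈ lowSpan k N C d :=
  monomial_mem_lowSpan (by rw [numLarge_single_one]; split_ifs <;> omega)
    (by rwa [wt_single_one])

theorem X_mul_X_mem_lowSpan {N C d : ℕ} {u v : ℕ+} (hu : (u : ℕ) ≤ N)
    (huv : (u : ℕ) + v + 2 * C ≤ d) : X u * X v ∈ lowSpan k N C d := by
  have : (X u * X v : SymWitt k) = monomial (Finsupp.single u 1 + Finsupp.single v 1) 1 :=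
    (monomial_add_one _ _).symm
  rw [this]
  refine monomial_mem_lowSpan ?_ ?_
  · rw [map_add, numLarge_single_one, numLarge_single_one]
    split_ifs <;> omega
  · rw [map_add, wt_single_one, wt_single_one]
    omega

/-- If modulo `J` every product of two variables with large index is a combination of monomials with
at most one such variable, of no larger weight, then the same holds for all monomials. -/
theorem filt_le_lowSpan_sup {N C : ℕ} {J : Ideal (SymWitt k)}
    (hJ : ∀ s t : ℕ+, X s * X t ∈ lowSpan k N C (s + t + 2 * C) ⊔ J.restrictScalars k) (n : ℕ) :
    filt k C n ≤ lowSpan k N C n ⊔ J.restrictScalars k := by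
  refine Submodule.span_le.2 ?_
  rintro _ ⟨α, hα, rfl⟩
  induction hr : numLarge N α using Nat.strong_induction_on generalizing α with
  | _ r ih =>
  subst hr
  by_cases h1 : numLarge N α ≤ 1
  · exact Submodule.mem_sup_left (monomial_mem_lowSpan h1 hα)
  obtain ⟨β', s, hs, rfl⟩ := exists_eq_add_single (N := N) (α := α) (by omega)
  rw [map_add, numLarge_single_one, if_pos hs] at h1
  obtain ⟨β, t, ht, rfl⟩ := exists_eq_add_single (N := N) (α := β') (by omega)
  obtain ⟨p, hp, q, hq, hpq⟩ := Submodule.mem_sup.1 (hJ t s)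
  have e : (monomial (β + Finsupp.single t 1 + Finsupp.single s 1) 1 : SymWitt k)
      = monomial β 1 * p + monomial β 1 * q := by
    rw [← mul_add, hpq, monomial_add_one, monomial_add_one, mul_assoc]
    rfl
  simp only [map_add, wt_single_one, numLarge_single_one, if_pos hs, if_pos ht] at hα ih
  rw [e]
  refine add_mem ?_ (Submodule.mem_sup_right (J.mul_mem_left _ hq))
  clear hpq e
  induction hp using Submodule.span_induction with
  | mem p hp =>
    obtain ⟨γ, hγ, hγ', rfl⟩ := hp
    rw [← monomial_add_one]
    -- Two large factors have been replaced by `γ`, which has at most one, so the number of large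
    -- factors drops.
    refine ih _ ?_ (β + γ) ?_ rfl
    · rw [map_add]; omega
    · rw [map_add]; omega
  | zero => rw [mul_zero]; exact zero_mem _
  | add p q _ _ hp hq => rw [mul_add]; exact add_mem hp hq
  | smul c p _ hp => rw [mul_smul_comm]; exact Submodule.smul_mem _ c hp

/-! ### Counting normal forms -/

/-- The products of a monomial in `x_1, ..., x_N` with exponents at most `n` by `1` or some `x_j`
with `j ≤ n`. -/
noncomputable def normalForm (k : Type*) [Field k] (N n : ℕ)
    (p : (Fin N → Fin (n + 1)) × Fin (n + 1)) : SymWitt k :=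
  (∏ i : Fin N, X (Nat.succPNat i) ^ (p.1 i : ℕ)) *
    if h : 0 < (p.2 : ℕ) then X ⟨p.2, h⟩ else 1

theorem monomial_eq_prod_of_numLarge_eq_zero {N : ℕ} {α : ℕ+ →₀ ℕ} (h : numLarge N α = 0) :
    (monomial α 1 : SymWitt k) = ∏ i : Fin N, X (Nat.succPNat i) ^ α (Nat.succPNat i) := by
  rw [monomial_eq, C_1, one_mul,
    Finsupp.prod_of_support_subset α (s := Finset.univ.image fun i : Fin N => Nat.succPNat i)]
  · rw [Finset.prod_image]
    intro i _ j _ hij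
    exact Fin.ext (Nat.succPNat_injective hij)
  · intro j hj
    have hjN : (j : ℕ) ≤ N := by
      by_contra hN
      have := Finsupp.le_weight (fun i : ℕ+ => if N < (i : ℕ) then 1 else 0) (s := j)
        (by simp only [if_pos (not_le.1 hN)]; exact one_ne_zero) α
      have h0 : α j ≤ numLarge N α := this
      exact Finsupp.mem_support_iff.1 hj (by omega)
    have := j.pos
    refine Finset.mem_image.2 ⟨⟨j - 1, by omega⟩, Finset.mem_univ _, PNat.eq ?_⟩
    simp only [Nat.succPNat_coe]
    omega
  · simp

theorem lowSpan_le_span_normalForm (N C n : ℕ) :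
    lowSpan k N C n ≤ Submodule.span k (Set.range (normalForm k N n)) := by
  refine Submodule.span_le.2 ?_
  rintro _ ⟨α, hα, hα', rfl⟩
  have hexp : ∀ (β : ℕ+ →₀ ℕ) (i : ℕ+), wt C β ≤ n → β i < n + 1 := fun β i hβ =>
    -- Every variable has positive weight, so an exponent is at most the weight of the monomial.
    Nat.lt_succ_of_le ((Finsupp.le_weight (fun i : ℕ+ => (i : ℕ) + C) (s := i)
      (by have := i.pos; omega) β).trans hβ)
  refine Submodule.subset_span ?_
  by_cases h0 : numLarge N α = 0
  -- The index `0`, which no variable has, encodes the absence of an extra factor.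
  · refine ⟨⟨fun i => ⟨α (Nat.succPNat i), hexp α _ hα'⟩, 0⟩, ?_⟩
    simp [normalForm, monomial_eq_prod_of_numLarge_eq_zero h0]
  · obtain ⟨β, j, hj, rfl⟩ := exists_eq_add_single h0
    rw [map_add, wt_single_one] at hα'
    rw [map_add, numLarge_single_one, if_pos hj] at hα
    refine ⟨⟨fun i => ⟨β (Nat.succPNat i), hexp β _ (by omega)⟩, ⟨j, by omega⟩⟩, ?_⟩
    rw [monomial_add_one, monomial_eq_prod_of_numLarge_eq_zero (N := N) (α := β) (by omega)]
    rw [normalForm, dif_pos j.pos]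
    rfl

/-! ### Iterated lowering of quadratic monomials -/

variable (k) in
/-- The span of the `x_u x_v` of smaller weight than `x_s x_t`, or of the same weight but
with `u < s`, and of the `x_u` with `u ≤ s + t + C`. -/
noncomputable def lowerSpan (C : ℕ) (s t : ℕ+) : Submodule k (SymWitt k) :=
  Submodule.span k ({p | ∃ u v : ℕ+, (u : ℕ) + v ≤ s + t ∧ ((u : ℕ) + v < s + t ∨ u < s) ∧
    X u * X v = p} ∪ {p | ∃ u : ℕ+, (u : ℕ) ≤ s + t + C ∧ X u = p})

theorem X_mul_X_mem_lowerSpan {C : ℕ} {s t u v : ℕ+} (h : (u : ℕ) + v ≤ s + t)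
    (h' : (u : ℕ) + v < s + t ∨ u < s) : X u * X v ∈ lowerSpan k C s t :=
  Submodule.subset_span (Or.inl ⟨u, v, h, h', rfl⟩)

theorem X_mem_lowerSpan {C : ℕ} {s t u : ℕ+} (h : (u : ℕ) ≤ s + t + C) :
    X u ∈ lowerSpan k C s t :=
  Submodule.subset_span (Or.inr ⟨u, h, rfl⟩)

/-- If modulo `J` every `x_s x_t` with `N < s ≤ t` can be lowered, then it is a combination of
monomials with at most one variable of index larger than `N`. -/
theorem X_mul_X_mem_lowSpan_sup {N C : ℕ} {J : Ideal (SymWitt k)}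
    (hJ : ∀ s t : ℕ+, N < (s : ℕ) → s ≤ t →
      X s * X t ∈ lowerSpan k C s t ⊔ J.restrictScalars k) (s t : ℕ+) :
    X s * X t ∈ lowSpan k N C (s + t + 2 * C) ⊔ J.restrictScalars k := by
  -- Lexicographic induction: on the index sum, then on the smaller index.
  induction hn : (s + t : ℕ) using Nat.strong_induction_on generalizing s t with
  | _ n ihn =>
  wlog hst : s ≤ t generalizing s t with H
  · rw [mul_comm (X s)]
    exact H t s (by omega) (le_of_not_ge hst)
  induction hs : (s : ℕ) using Nat.strong_induction_on generalizing s t with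
  | _ r ihs =>
  by_cases hN : (s : ℕ) ≤ N
  · exact Submodule.mem_sup_left (X_mul_X_mem_lowSpan hN (by omega))
  refine (sup_le (Submodule.span_le.2 ?_) le_sup_right :
    lowerSpan k C s t ⊔ J.restrictScalars k ≤ _) (hJ s t (by omega) hst)
  rintro _ (⟨u, v, huv, h, rfl⟩ | ⟨u, hu, rfl⟩)
  · by_cases hlt : (u : ℕ) + v < s + t
    · have hle : lowSpan k N C (u + v + 2 * C) ≤ lowSpan k N C (n + 2 * C) :=
        lowSpan_mono N C (by omega)
      exact (sup_le_sup_right hle (J.restrictScalars k)) (ihn _ (by omega) u v rfl)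
    -- With equal sums, `u < s ≤ t` forces `t < v`, so the new pair is again ordered and the inner
    -- induction applies.
    · have hus : (u : ℕ) < s := h.resolve_left hlt
      have hst' : (s : ℕ) ≤ t := hst
      refine ihs u (by omega) u v (by omega) ?_ rfl
      rw [← PNat.coe_le_coe]
      omega
  · exact Submodule.mem_sup_left (X_mem_lowSpan (by omega))

/-! ### Double brackets and their leading terms -/

theorem adX_X (a i : ℕ+) : adX k a (X i) = (((i : ℕ) : k) - ((a : ℕ) : k)) • X (a + i) := by
  rw [adX, mkDerivation_X]

theorem adX_adX_X (a b i : ℕ+) :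
    adX k a (adX k b (X i))
      = ((((i : ℕ) : k) - (b : ℕ)) * (((b + i : ℕ+) : ℕ) - (a : ℕ) : k)) • X (a + (b + i)) := by
  rw [adX_X, Derivation.map_smul, adX_X, smul_smul]

/-- The last two terms, in which the brackets hit different factors, are the only ones that can have
two large indices when `a`, `b` are large; the leading term is among them. -/
theorem adX_adX_X_mul_X (a b i j : ℕ+) :
    adX k a (adX k b (X i * X j))
      = X j * adX k a (adX k b (X i)) + X i * adX k a (adX k b (X j))
        + ((((i : ℕ) : k) - (b : ℕ)) * (((j : ℕ) : k) - (a : ℕ))) • (X (a + j) * X (b + i))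
        + ((((i : ℕ) : k) - (a : ℕ)) * (((j : ℕ) : k) - (b : ℕ))) • (X (a + i) * X (b + j)) := by
  simp only [Derivation.leibniz, map_add, smul_eq_mul, adX_X]
  simp only [smul_eq_C_mul, C_mul]
  ring

/-- The monomials of degree at most two. -/
theorem eq_single_add_single_of_degree_le_two {α : ℕ+ →₀ ℕ} (h : α.degree ≤ 2) :
    α = 0 ∨ (∃ i, α = Finsupp.single i 1) ∨
      ∃ i j, i ≤ j ∧ α = Finsupp.single i 1 + Finsupp.single j 1 := by
  have key : ∀ β : ℕ+ →₀ ℕ, β ≠ 0 → ∃ γ i, β = γ + Finsupp.single i 1 ∧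
      β.degree = γ.degree + 1 := by
    intro β hβ
    obtain ⟨i, hi⟩ := Finsupp.ne_iff.1 hβ
    refine ⟨β - Finsupp.single i 1, i, (Finsupp.sub_add_single_one_cancel hi).symm, ?_⟩
    conv_lhs => rw [← Finsupp.sub_add_single_one_cancel hi, map_add, Finsupp.degree_single]
  by_cases h0 : α = 0
  · exact Or.inl h0
  obtain ⟨β, i, rfl, hd⟩ := key α h0
  by_cases h1 : β = 0
  · exact Or.inr (Or.inl ⟨i, by rw [h1, zero_add]⟩)
  obtain ⟨γ, j, rfl, hd'⟩ := key β h1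
  have h2 : γ = 0 := (Finsupp.degree_eq_zero_iff γ).1 (by omega)
  subst h2
  refine Or.inr (Or.inr ?_)
  rcases le_total i j with hij | hij
  · exact ⟨i, j, hij, by rw [zero_add, add_comm]⟩
  · exact ⟨j, i, hij, by rw [zero_add]⟩

/-- The summand `x_i x_j` of `f` contributes lower terms to `{x_a, {x_b, f}}`, with the exception of
the leading monomial. -/
theorem adX_adX_X_mul_X_mem {m : ℕ} {a b i j i₀ j₀ : ℕ+} (hij : i ≤ j) (hj : (j : ℕ) ≤ m)
    (ha : m < (a : ℕ))
    (hle : (i : ℕ) + j < i₀ + j₀ ∨ ((i : ℕ) + j = i₀ + j₀ ∧ j < j₀)) :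
    adX k a (adX k b (X i * X j)) ∈ lowerSpan k m (a + j₀) (b + i₀) := by
  have hij' : (i : ℕ) ≤ j := hij
  simp only [← PNat.coe_lt_coe] at hle
  have hlow : ∀ u v : ℕ+, (u : ℕ) + v ≤ (a + j₀ : ℕ) + (b + i₀ : ℕ) →
      ((u : ℕ) + v < (a + j₀ : ℕ) + (b + i₀ : ℕ) ∨ (u : ℕ) < a + j₀) → ∀ c : k,
      c • (X u * X v) ∈ lowerSpan k m (a + j₀) (b + i₀) := by
    intro u v h h' c
    refine Submodule.smul_mem _ c (X_mul_X_mem_lowerSpan ?_ ?_)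
    · simpa only [PNat.add_coe] using h
    · simpa only [← PNat.coe_lt_coe, PNat.add_coe] using h'
  rw [adX_adX_X_mul_X, adX_adX_X, adX_adX_X, mul_smul_comm, mul_smul_comm]
  -- If both brackets hit the same factor, the other keeps an index at most `m < a`. In the cross
  -- terms the first index is `a + j` or `a + i`, and `i ≤ j < j₀` when the sums agree.
  refine add_mem (add_mem (add_mem ?_ ?_) ?_) ?_ <;> apply hlow <;>
    simp only [PNat.add_coe] <;> omega

/-- The leading monomial of `{x_a, {x_b, f}}`. -/
theorem exists_adX_adX_leading [CharZero k] {m : ℕ} {a b i₀ j₀ : ℕ+} (hij : i₀ ≤ j₀)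
    (hj₀ : (j₀ : ℕ) ≤ m) (ha : m < (a : ℕ)) (hb : m < (b : ℕ)) :
    ∃ c : k, c ≠ 0 ∧ adX k a (adX k b (X i₀ * X j₀)) - c • (X (a + j₀) * X (b + i₀))
      ∈ lowerSpan k m (a + j₀) (b + i₀) := by
  have hij' : (i₀ : ℕ) ≤ j₀ := hij
  have hne : ∀ u v : ℕ+, (u : ℕ) ≤ m → m < (v : ℕ) → ((u : ℕ) : k) - ((v : ℕ) : k) ≠ 0 := by
    intro u v hu hv h
    have := Nat.cast_injective (sub_eq_zero.1 h)
    omega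
  have h1 : ∀ c : k, c • (X i₀ * X (a + (b + j₀))) ∈ lowerSpan k m (a + j₀) (b + i₀) := by
    intro c
    refine Submodule.smul_mem _ c (X_mul_X_mem_lowerSpan ?_ (Or.inr ?_))
    · simp only [PNat.add_coe]; omega
    · simp only [← PNat.coe_lt_coe, PNat.add_coe]; omega
  have h2 : ∀ c : k, c • (X j₀ * X (a + (b + i₀))) ∈ lowerSpan k m (a + j₀) (b + i₀) := by
    intro c
    refine Submodule.smul_mem _ c (X_mul_X_mem_lowerSpan ?_ (Or.inr ?_))
    · simp only [PNat.add_coe]; omega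
    · simp only [← PNat.coe_lt_coe, PNat.add_coe]; omega
  rw [adX_adX_X_mul_X, adX_adX_X, adX_adX_X, mul_smul_comm, mul_smul_comm]
  -- For `i₀ = j₀` the two cross terms coincide and the coefficient doubles; otherwise the second
  -- one has first index `a + i₀ < a + j₀` and is lower.
  rcases hij.eq_or_lt with rfl | hlt
  · refine ⟨2 * ((((i₀ : ℕ) : k) - (b : ℕ)) * (((i₀ : ℕ) : k) - (a : ℕ))),
      mul_ne_zero two_ne_zero (mul_ne_zero (hne _ _ hj₀ hb) (hne _ _ hj₀ ha)), ?_⟩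
    rw [show ∀ (x y z : SymWitt k) (c c' : k),
      x + y + (c * c') • z + (c' * c) • z - (2 * (c * c')) • z = x + y from
        fun _ _ _ _ _ => by module]
    exact add_mem (h2 _) (h1 _)
  · have hlt' : (i₀ : ℕ) < j₀ := hlt
    refine ⟨(((i₀ : ℕ) : k) - (b : ℕ)) * (((j₀ : ℕ) : k) - (a : ℕ)),
      mul_ne_zero (hne _ _ (by omega) hb) (hne _ _ hj₀ ha), ?_⟩
    have h3 : ∀ c : k, c • (X (a + i₀) * X (b + j₀)) ∈ lowerSpan k m (a + j₀) (b + i₀) := by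
      intro c
      refine Submodule.smul_mem _ c (X_mul_X_mem_lowerSpan ?_ (Or.inr ?_))
      · simp only [PNat.add_coe]; omega
      · simp only [← PNat.coe_lt_coe, PNat.add_coe]; omega
    rw [show ∀ x y z w : SymWitt k, x + y + z + w - z = x + y + w from fun _ _ _ _ => by ring]
    exact add_mem (add_mem (h2 _) (h1 _)) (h3 _)

/-- Given `s` and `t`, put `a = s - j₀` and `b = t - i₀` and solve `{x_a, {x_b, f}} ∈ J` for its
leading term. -/
theorem exists_X_mul_X_mem_lowerSpan_sup [CharZero k] {J : Ideal (SymWitt k)}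
    (hJ : (poisson k).IsPoissonIdeal J) {f : SymWitt k} (hf : f ∈ J) (hdeg : f.totalDegree = 2) :
    ∃ N C : ℕ, ∀ s t : ℕ+, N < (s : ℕ) → s ≤ t →
      X s * X t ∈ lowerSpan k C s t ⊔ J.restrictScalars k := by
  classical
  have hle : ∀ α ∈ f.support, α.degree ≤ 2 := fun α hα => hdeg ▸ le_totalDegree hα
  obtain ⟨m, hm⟩ : ∃ m : ℕ, ∀ i ∈ f.vars, (i : ℕ) ≤ m :=
    ⟨f.vars.sup (fun i => (i : ℕ)), fun i hi => Finset.le_sup (f := fun i : ℕ+ => (i : ℕ)) hi⟩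
  have hm' : ∀ α ∈ f.support, ∀ i, α i ≠ 0 → (i : ℕ) ≤ m := fun α hα i hi =>
    hm i ((mem_vars_iff_mem_support i).2 ⟨α, hα, Finsupp.mem_support_iff.2 hi⟩)
  let Q := (f.vars ×ˢ f.vars).filter fun p =>
    p.1 ≤ p.2 ∧ Finsupp.single p.1 1 + Finsupp.single p.2 1 ∈ f.support
  have hQ : ∀ i j, i ≤ j → Finsupp.single i 1 + Finsupp.single j 1 ∈ f.support → (i, j) ∈ Q := by
    intro i j hij h
    refine Finset.mem_filter.2 ⟨Finset.mem_product.2 ⟨?_, ?_⟩, hij, h⟩ <;>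
    exact (mem_vars_iff_mem_support _).2 ⟨_, h, by simp⟩
  have hne : Q.Nonempty := by
    obtain ⟨α, hα, hα2⟩ : ∃ α ∈ f.support, α.degree = 2 := by
      obtain ⟨α, hα, h⟩ := Finset.exists_mem_eq_sup f.support
        (Finset.nonempty_iff_ne_empty.2 fun h => by
          rw [support_eq_empty.1 h, totalDegree_zero] at hdeg; omega)
        (fun s => s.sum fun _ e => e)
      exact ⟨α, hα, h.symm.trans hdeg⟩
    rcases eq_single_add_single_of_degree_le_two hα2.le with rfl | ⟨i, rfl⟩ | ⟨i, j, hij, rfl⟩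
    · simp at hα2
    · simp at hα2
    · exact ⟨_, hQ i j hij hα⟩
  -- Largest index sum first, then the largest second index: this matches the order by which
  -- `lowerSpan` compares the products.
  obtain ⟨⟨i₀, j₀⟩, h₀, hmax⟩ := Finset.exists_max_image Q
    (fun p => toLex ((p.1 : ℕ) + (p.2 : ℕ), (p.2 : ℕ))) hne
  obtain ⟨hvars, hij₀, hsupp₀⟩ := Finset.mem_filter.1 h₀
  have hi₀ := hm _ (Finset.mem_product.1 hvars).1
  have hj₀ := hm _ (Finset.mem_product.1 hvars).2
  simp only at hi₀ hj₀ hij₀ hsupp₀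
  -- As `i₀, j₀ ≤ m`, the bound `2 * m` makes both `a` and `b` exceed `m`. The offset `m` covers the
  -- indices `a + b + i` that come from linear terms `x_i`.
  refine ⟨2 * m, m, fun s t hs hst => ?_⟩
  have hst' : (s : ℕ) ≤ t := hst
  obtain ⟨a, rfl⟩ : ∃ a, s = a + j₀ :=
    ⟨s - j₀, (PNat.sub_add_of_lt (by rw [← PNat.coe_lt_coe]; omega)).symm⟩
  obtain ⟨b, rfl⟩ : ∃ b, t = b + i₀ :=
    ⟨t - i₀, (PNat.sub_add_of_lt (by rw [← PNat.coe_lt_coe]; omega)).symm⟩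
  rw [PNat.add_coe] at hs hst'
  rw [PNat.add_coe] at hst'
  obtain ⟨c, hc, hlead⟩ := exists_adX_adX_leading (k := k) (m := m) (a := a) (b := b) hij₀ hj₀
    (by omega) (by omega)
  set L := lowerSpan k m (a + j₀) (b + i₀) with hL
  set α₀ := Finsupp.single i₀ 1 + Finsupp.single j₀ 1 with hα₀
  let D : SymWitt k →ₗ[k] SymWitt k := (adX k a).toLinearMap ∘ₗ (adX k b).toLinearMap
  have hXX : ∀ i j : ℕ+, (X i * X j : SymWitt k)
      = monomial (Finsupp.single i 1 + Finsupp.single j 1) 1 := fun i j =>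
    (monomial_add_one _ _).symm
  have hother : ∀ α ∈ f.support.erase α₀, D (monomial α (coeff α f)) ∈ L := by
    intro α hα
    obtain ⟨hαne, hα⟩ := Finset.mem_erase.1 hα
    rw [← mul_one (coeff α f), ← smul_eq_mul, ← smul_monomial, map_smul]
    refine Submodule.smul_mem _ _ ?_
    rcases eq_single_add_single_of_degree_le_two (hle α hα) with rfl | ⟨i, rfl⟩ | ⟨i, j, hij, rfl⟩
    · have : D (monomial 0 1) = 0 := by
        change adX k a (adX k b 1) = 0
        simp
      rw [this]
      exact zero_mem _
    · change adX k a (adX k b (X i)) ∈ L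
      rw [adX_adX_X]
      refine Submodule.smul_mem _ _ (X_mem_lowerSpan ?_)
      have := hm' _ hα i (by simp)
      simp only [PNat.add_coe]
      omega
    · rw [← hXX]
      have hj := hm' _ hα j (by simp)
      refine adX_adX_X_mul_X_mem hij hj (by omega) ?_
      have h := hmax _ (hQ i j hij hα)
      rw [Prod.Lex.toLex_le_toLex] at h
      simp only at h
      rcases h with h | ⟨h, h'⟩
      · exact Or.inl h
      · refine Or.inr ⟨h, lt_of_le_of_ne h' fun e => hαne ?_⟩
        have e' : i = i₀ := PNat.eq (by rw [e] at h; omega)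
        rw [e, e']
  have hDf : D f ∈ J := by
    have h1 := hJ (X b) f hf
    have h2 := hJ (X a) _ h1
    change bracket k (X a) (bracket k (X b) f) ∈ J at h2
    rwa [bracket_X_left, bracket_X_left] at h2
  have hsum : D f - coeff α₀ f • D (X i₀ * X j₀) ∈ L := by
    have : D f - coeff α₀ f • D (X i₀ * X j₀)
        = ∑ α ∈ f.support.erase α₀, D (monomial α (coeff α f)) := by
      rw [sub_eq_iff_eq_add', hXX, ← map_smul, smul_monomial, smul_eq_mul, mul_one,
        Finset.add_sum_erase _ (fun α => D (monomial α (coeff α f))) hsupp₀, ← map_sum, ← f.as_sum]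
    rw [this]
    exact Submodule.sum_mem _ hother
  have hcoef : coeff α₀ f ≠ 0 := mem_support_iff.1 hsupp₀
  have hscaled : (coeff α₀ f * c) • (X (a + j₀) * X (b + i₀)) ∈ L ⊔ J.restrictScalars k := by
    have e : (coeff α₀ f * c) • (X (a + j₀) * X (b + i₀) : SymWitt k)
        = -(D f - coeff α₀ f • D (X i₀ * X j₀)) - coeff α₀ f •
          (D (X i₀ * X j₀) - c • (X (a + j₀) * X (b + i₀))) + D f := by
      module
    rw [e]
    exact add_mem (Submodule.mem_sup_left
      (sub_mem (neg_mem hsum) (Submodule.smul_mem _ _ hlead))) (Submodule.mem_sup_right hDf)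
  exact (Submodule.smul_mem_iff _ (mul_ne_zero hcoef hc)).1 hscaled

/-- Multiplication by a power of `x_1` makes the order equal to two. -/
theorem exists_mem_totalDegree_eq_two {J : Ideal (SymWitt k)}
    (h : ∃ f ∈ J, f ≠ 0 ∧ order f ≤ 2) : ∃ f ∈ J, f.totalDegree = 2 := by
  obtain ⟨f, hf, h0, h2⟩ := h
  refine ⟨X 1 ^ (2 - f.totalDegree) * f, J.mul_mem_left _ hf, ?_⟩
  rw [totalDegree_mul_of_isDomain (pow_ne_zero _ (X_ne_zero _)) h0, totalDegree_X_pow]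
  have : f.totalDegree ≤ 2 := h2
  omega

end SymWitt

/-! ### Filtrations of polynomial growth bound the Poisson Gelfand–Kirillov dimension -/

namespace PoissonStructure

variable {k A : Type*} [Field k] [CommRing A] [Algebra k A] (P : PoissonStructure k A)

/-- A filtration compatible with the Poisson structure contains the subspaces `V^{i}`. -/
theorem bracePow_le {F : ℕ → Submodule k A} (h1 : 1 ≤ F 0)
    (hmul : ∀ m n, ∀ a ∈ F m, ∀ b ∈ F n, a * b ∈ F (m + n))
    (hbr : ∀ m n, ∀ a ∈ F m, ∀ b ∈ F n, P.bracket a b ∈ F (m + n))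
    {V : Submodule k A} {d : ℕ} (hV : V ≤ F d) (n : ℕ) : P.bracePow V n ≤ F (d * n) := by
  induction n with
  | zero => exact h1
  | succ n ih =>
    rw [mul_add, mul_one, add_comm (d * n)]
    exact sup_le (Submodule.mul_le.2 fun a ha b hb => hmul _ _ _ (hV ha) _ (ih hb))
      (Submodule.map₂_le.2 fun a ha b hb => hbr _ _ _ (hV ha) _ (ih hb))

/-- A Poisson algebra with an exhaustive filtration of polynomial growth, compatible with the product
and the bracket, has finite Poisson Gelfand-Kirillov dimension. -/
theorem pgkDim_le_of_filtration {F : ℕ → Submodule k A} (hmono : Monotone F) (h1 : 1 ≤ F 0)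
    (hmul : ∀ m n, ∀ a ∈ F m, ∀ b ∈ F n, a * b ∈ F (m + n))
    (hbr : ∀ m n, ∀ a ∈ F m, ∀ b ∈ F n, P.bracket a b ∈ F (m + n))
    (hexh : ∀ a, ∃ n, a ∈ F n) (hfin : ∀ n, FiniteDimensional k (F n)) {e : ℕ}
    (hdim : ∀ n, Module.finrank k (F n) ≤ (n + 1) ^ e) : P.pgkDim ≤ e := by
  refine iSup_le fun B => iSup_le fun V => iSup_le fun hfd => iSup_le fun _ => ?_
  obtain ⟨d, hd⟩ : ∃ d, V ≤ F d := by
    obtain ⟨S, rfl⟩ := (Submodule.fg_iff_finiteDimensional V).2 hfd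
    choose g hg using hexh
    exact ⟨S.sup g, Submodule.span_le.2 fun a ha => hmono (Finset.le_sup ha) (hg a)⟩
  have hpd : ∀ n, P.pd V n ≤ (d * n + 1) ^ e := fun n => by
    refine (Submodule.finrank_mono (iSup₂_le fun i hi => ?_)).trans (hdim (d * n))
    exact (P.bracePow_le h1 hmul hbr hd i).trans
      (hmono (Nat.mul_le_mul_left d (Nat.lt_succ_iff.1 (Finset.mem_range.1 hi))))
  have hgrowth : GrowthLE (fun n => (P.pd V n : ℝ)) (fun n => (n : ℝ) ^ ((e : ℝ≥0) : ℝ)) := by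
    -- The dilation `d + 1` absorbs the summand in `d * n + 1` once `n ≥ 1`.
    refine ⟨1, d + 1, Filter.eventually_atTop.2 ⟨1, fun n hn => ?_⟩⟩
    have : P.pd V n ≤ ((d + 1) * n) ^ e :=
      (hpd n).trans (Nat.pow_le_pow_left (by rw [add_mul, one_mul]; omega) e)
    simp only [NNReal.coe_natCast, Real.rpow_natCast, Nat.cast_one, one_mul]
    exact_mod_cast this
  exact (iInf₂_le (e : ℝ≥0) hgrowth).trans (by simp)

end PoissonStructure

/-! ### The weight filtration on the quotient -/

open SymWitt in
theorem proposition4p8 {k : Type*} [Field k] [CharZero k] (J : Ideal (SymWitt k))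
    (hJ : (SymWitt.poisson k).IsPoissonIdeal J)
    (h : ∃ f ∈ J, f ≠ 0 ∧ SymWitt.order f ≤ 2) :
    ((SymWitt.poisson k).quotient J hJ).pgkDim < ⊤ := by
  obtain ⟨f, hf, hdeg⟩ := exists_mem_totalDegree_eq_two h
  obtain ⟨N, C, hred⟩ := exists_X_mul_X_mem_lowerSpan_sup hJ hf hdeg
  let π : SymWitt k →ₗ[k] SymWitt k ⧸ J := (Ideal.Quotient.mkₐ k J).toLinearMap
  have hspan : ∀ n, (filt k C n).map π
      ≤ Submodule.span k (Set.range (π ∘ normalForm k N n)) := by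
    intro n
    rw [Set.range_comp, ← Submodule.map_span]
    refine (Submodule.map_mono (filt_le_lowSpan_sup (X_mul_X_mem_lowSpan_sup hred) n)).trans ?_
    rw [Submodule.map_sup]
    refine sup_le (Submodule.map_mono (lowSpan_le_span_normalForm N C n)) ?_
    rintro _ ⟨p, hp, rfl⟩
    have : π p = 0 := Ideal.Quotient.eq_zero_iff_mem.2 hp
    rw [this]
    exact zero_mem _
  have hspanfin : ∀ n, FiniteDimensional k
      (Submodule.span k (Set.range (π ∘ normalForm k N n))) := fun n =>
    FiniteDimensional.span_of_finite k (Set.finite_range _)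
  refine lt_of_le_of_lt (PoissonStructure.pgkDim_le_of_filtration _
    (F := fun n => (filt k C n).map π) (e := N + 1) (fun m n hmn => Submodule.map_mono
      (filt_mono C hmn)) ?_ ?_ ?_ ?_ (fun n => Submodule.finiteDimensional_of_le (hspan n))
    fun n => ?_) (ENNReal.natCast_lt_top (N + 1))
  · refine Submodule.one_le.2 ⟨1, ?_, map_one (Ideal.Quotient.mkₐ k J)⟩
    exact monomial_mem_filt (α := 0) (by simp)
  · rintro m n _ ⟨p, hp, rfl⟩ _ ⟨q, hq, rfl⟩
    exact ⟨p * q, mul_mem_filt hp hq, map_mul (Ideal.Quotient.mkₐ k J) p q⟩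
  · rintro m n _ ⟨p, hp, rfl⟩ _ ⟨q, hq, rfl⟩
    exact ⟨_, bracket_mem_filt hp hq, rfl⟩
  · intro a
    obtain ⟨p, rfl⟩ := Ideal.Quotient.mk_surjective a
    obtain ⟨n, hn⟩ := exists_mem_filt C p
    exact ⟨n, p, hn, rfl⟩
  -- A normal form is given by `N` exponents and one index, each with `n + 1` possible values.
  · refine (Submodule.finrank_mono (hspan n)).trans ((finrank_range_le_card _).trans ?_)
    simp [pow_succ]
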